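/- Let $M$ be a Riemannian manifold, let $\mathrm{Isom}(M)$ be its isometry group, and let $S$ be a connected Lie subgroup of $\mathrm{Isom}(M)$, with Lie algebra $\mathfrak{s}$, that acts transitively on $M$. Let $\mathfrak{s}'$ be an ideal of $\mathfrak{s}$, and let $S'$ be the connected Lie subgroup of $S$ with Lie algebra $\mathfrak{s}'$. Then all orbits of $S'$ in $M$ are isometrically congruent to each other; that is, for all $p, q \in M$ there is an isometry $f \in \mathrm{Isom}(M)$ with $f(S'.p) = S'.q$. (Lie subgroups are injectively immersed and need not be closed.) -/

import Mathlib

open scoped Manifold ContDiff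
open Bundle

noncomputable section

section RiemannianIsometries

variable {m : ℕ} {M : Type*} [TopologicalSpace M] [ChartedSpace (EuclideanSpace ℝ (Fin m)) M]
  [IsManifold (𝓡 m) ∞ M]

/-- A smooth Riemannian metric on the `m`-dimensional smooth manifold `M`: a smoothly varying
family of inner products on the tangent spaces of `M`. -/
abbrev SmoothRiemannianMetric (m : ℕ) (M : Type*) [TopologicalSpace M]
    [ChartedSpace (EuclideanSpace ℝ (Fin m)) M] [IsManifold (𝓡 m) ∞ M] :=
  ContMDiffRiemannianMetric (𝓡 m) ∞ (EuclideanSpace ℝ (Fin m))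
    (fun x : M => TangentSpace (𝓡 m) x)

/-- `f` is a Riemannian isometry of `(M, g)` onto itself: a smooth diffeomorphism whose
differential preserves the metric `g`. -/
structure IsRiemannianIsometry (g : SmoothRiemannianMetric m M) (f : M ≃ₜ M) : Prop where
  contMDiff_toFun : ContMDiff (𝓡 m) (𝓡 m) ∞ f
  contMDiff_invFun : ContMDiff (𝓡 m) (𝓡 m) ∞ f.symm
  inner_mfderiv : ∀ (x : M) (v w : TangentSpace (𝓡 m) x),
    g.inner (f x) (mfderiv (𝓡 m) (𝓡 m) f x v) (mfderiv (𝓡 m) (𝓡 m) f x w) = g.inner x v w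

/-- The isometry group `Isom(M)` of the Riemannian manifold `(M, g)`. -/
def isometryGroup (g : SmoothRiemannianMetric m M) : Subgroup (M ≃ₜ M) where
  carrier := {f | IsRiemannianIsometry g f}
  one_mem' := by
    refine ⟨contMDiff_id, contMDiff_id, fun x v w => ?_⟩
    have h : mfderiv (𝓡 m) (𝓡 m) ((1 : M ≃ₜ M) : M → M) x = ContinuousLinearMap.id ℝ _ :=
      mfderiv_id
    rw [h]
    rfl
  mul_mem' := by
    intro a b ha hb
    refine ⟨ha.contMDiff_toFun.comp hb.contMDiff_toFun,
      hb.contMDiff_invFun.comp ha.contMDiff_invFun, fun x v w => ?_⟩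
    have h : mfderiv (𝓡 m) (𝓡 m) ((a * b : M ≃ₜ M) : M → M) x =
        (mfderiv (𝓡 m) (𝓡 m) a (b x)).comp (mfderiv (𝓡 m) (𝓡 m) b x) :=
      mfderiv_comp x (ha.contMDiff_toFun.mdifferentiableAt (by simp))
        (hb.contMDiff_toFun.mdifferentiableAt (by simp))
    rw [h]
    exact (ha.inner_mfderiv (b x) _ _).trans (hb.inner_mfderiv x v w)
  inv_mem' := by
    intro a ha
    refine ⟨ha.contMDiff_invFun, ha.contMDiff_toFun, fun x v w => ?_⟩
    have h : (mfderiv (𝓡 m) (𝓡 m) a (a.symm x)).comp (mfderiv (𝓡 m) (𝓡 m) a.symm x) =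
        ContinuousLinearMap.id ℝ _ := by
      have h1 := mfderiv_comp x (I := 𝓡 m) (I' := 𝓡 m) (I'' := 𝓡 m)
        (ha.contMDiff_toFun.mdifferentiableAt (x := a.symm x) (by simp))
        (ha.contMDiff_invFun.mdifferentiableAt (by simp))
      rw [← h1]
      have h2 : (a : M → M) ∘ a.symm = id := by
        ext y
        simp
      rw [h2]
      exact mfderiv_id
    have key := ha.inner_mfderiv (a.symm x) (mfderiv (𝓡 m) (𝓡 m) a.symm x v)
      (mfderiv (𝓡 m) (𝓡 m) a.symm x w)
    have hv : mfderiv (𝓡 m) (𝓡 m) a (a.symm x) (mfderiv (𝓡 m) (𝓡 m) a.symm x v) = v :=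
      congrArg (fun L => L v) h
    have hw : mfderiv (𝓡 m) (𝓡 m) a (a.symm x) (mfderiv (𝓡 m) (𝓡 m) a.symm x w) = w :=
      congrArg (fun L => L w) h
    rw [hv, hw] at key
    refine key.symm.trans ?_
    rw [a.apply_symm_apply x]

/-- The natural action of `Isom(M)` on `M`. -/
instance isometryGroup.instMulAction (g : SmoothRiemannianMetric m M) :
    MulAction (isometryGroup g) M where
  smul f x := f.1 x
  one_smul _ := rfl
  mul_smul _ _ _ := rfl

/-- The compact-open topology on `Isom(M)`; it is the topology underlying the Lie group structure
of `Isom(M)`. -/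
instance isometryGroup.instTopologicalSpace (g : SmoothRiemannianMetric m M) :
    TopologicalSpace (isometryGroup g) :=
  TopologicalSpace.induced (fun f => (⟨f.1, f.1.continuous⟩ : C(M, M))) inferInstance

/-- Let `S` be a Lie group. The homomorphism `ι : S →* Isom(M)` makes `S` a Lie subgroup of
`Isom(M)`: it is injective, and continuous for the compact-open topology. Continuous homomorphisms
between Lie groups are smooth, and injective ones are then immersions, so this says exactly that
`(S, ι)` is an injectively immersed (not necessarily closed) Lie subgroup of `Isom(M)`, where
`Isom(M)` has the unique Lie group structure that is compatible with its topology. -/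
structure IsLieSubgroupOfIsometryGroup {g : SmoothRiemannianMetric m M} {S : Type*}
    [TopologicalSpace S] [Group S] (ι : S →* isometryGroup g) : Prop where
  injective : Function.Injective ι
  continuous : Continuous ι

/-- Two subsets `A`, `B` of the Riemannian manifold `(M, g)` are isometrically congruent:
some isometry of `M` maps `A` onto `B`. -/
def IsometricallyCongruent (g : SmoothRiemannianMetric m M) (A B : Set M) : Prop :=
  ∃ f : isometryGroup g, (fun x => f • x) '' A = B

end RiemannianIsometries

section LieSubgroups

/-- A smooth real Lie group has the smoothness that is needed for the Lie bracket on its tangent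
space at the identity. -/
instance LieGroup.instMinSmoothnessThree {n : ℕ} {G : Type*} [TopologicalSpace G]
    [ChartedSpace (EuclideanSpace ℝ (Fin n)) G] [Group G] [LieGroup (𝓡 n) ∞ G] :
    LieGroup (𝓡 n) (minSmoothness ℝ 3) G :=
  LieGroup.of_le (n := ∞) (by simpa using ENat.LEInfty.out)

variable (k n : ℕ)
  {K : Type*} [TopologicalSpace K] [ChartedSpace (EuclideanSpace ℝ (Fin k)) K] [Group K]
  {G : Type*} [TopologicalSpace G] [ChartedSpace (EuclideanSpace ℝ (Fin n)) G] [Group G]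

/-- The homomorphism `j : K →* G` of Lie groups makes `K` a Lie subgroup of `G`: it is a smooth
injective immersion. -/
structure IsLieSubgroup (j : K →* G) : Prop where
  injective : Function.Injective j
  contMDiff : ContMDiff (𝓡 k) (𝓡 n) ∞ j
  mfderiv_injective : ∀ x : K, Function.Injective (mfderiv (𝓡 k) (𝓡 n) j x)

/-- The differential at the identity `Lie(K) → Lie(G)` of a homomorphism `j : K →* G` of Lie
groups. (The tangent space of `G` at `j 1` is the one at `1`, as `j 1 = 1`.) -/
def lieAlgebraMap (j : K →* G) : GroupLieAlgebra (𝓡 k) K →L[ℝ] GroupLieAlgebra (𝓡 n) G :=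
  mfderiv (𝓡 k) (𝓡 n) j 1

/-- The Lie algebra of the Lie subgroup `j : K →* G`, as a subspace of `Lie(G)`. -/
def lieSubgroupLieAlgebra (j : K →* G) : Submodule ℝ (GroupLieAlgebra (𝓡 n) G) :=
  LinearMap.range (lieAlgebraMap k n j).toLinearMap

end LieSubgroups

end

/-! Everything reduces to normality of the subgroup `S'`. If `s` carries `p` to `q`, then `s S' p =
(s S' s⁻¹) (s p) = S' q`, so the isometry `ι s` maps one orbit onto the other.

Normality is obtained without the exponential map, from first-order differential inequalities in the
charts at the identities. The derivative of `Ad` at the identity is the Lie bracket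
(`exists_hasFDerivAt_adjointMap`), so an ideal `W` is preserved infinitesimally. The obstruction to
`Ad g` preserving `W` then has derivative bounded by a multiple of itself and vanishes near the
identity (`eventually_eq_zero_of_hasFDerivAt_le`); connectedness extends this to the whole group
(`adjointMap_mem_of_lie_mem`).

Since the subgroup need not be closed, it is detected by a local coordinate transverse to its left
cosets (`exists_transversal_coordinate`). Along a conjugate of the subgroup this coordinate has zero
derivative, because `Ad s` preserves the Lie algebra; hence the conjugate lies in the subgroup,
first near the identity and then everywhere (`conj_mem_range_of_adjointMap_mem`). -/

noncomputable section

open Filter Topology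

/-! ### Coordinates at the identity -/

section Coordinates

variable (n : ℕ) (G : Type*) [TopologicalSpace G] [ChartedSpace (EuclideanSpace ℝ (Fin n)) G]
  [Group G]

/-- The extended chart of a Lie group at the identity. -/
def oneChart : PartialEquiv G (EuclideanSpace ℝ (Fin n)) := extChartAt (𝓡 n) (1 : G)

/-- The coordinates of the identity in the chart at the identity. -/
abbrev oneCoord : EuclideanSpace ℝ (Fin n) := oneChart n G 1

variable {n G}

lemma oneChart_symm_oneCoord : (oneChart n G).symm (oneCoord n G) = 1 :=
  extChartAt_to_inv (I := 𝓡 n) (1 : G)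

lemma oneCoord_mem_target : oneCoord n G ∈ (oneChart n G).target :=
  mem_extChartAt_target (I := 𝓡 n) (1 : G)

lemma eventually_mem_oneChart_target : ∀ᶠ u in 𝓝 (oneCoord n G), u ∈ (oneChart n G).target :=
  extChartAt_target_mem_nhds (I := 𝓡 n) (1 : G)

lemma eventually_mem_oneChart_source : ∀ᶠ x in 𝓝 (1 : G), x ∈ (oneChart n G).source :=
  extChartAt_source_mem_nhds (I := 𝓡 n) (1 : G)

lemma continuousAt_oneChart {x : G} (hx : x ∈ (oneChart n G).source) :
    ContinuousAt (oneChart n G) x :=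
  continuousAt_extChartAt' hx

lemma continuousAt_oneChart_symm {u : EuclideanSpace ℝ (Fin n)}
    (hu : u ∈ (oneChart n G).target) : ContinuousAt (oneChart n G).symm u :=
  continuousAt_extChartAt_symm'' hu

lemma tendsto_oneChart : Tendsto (oneChart n G) (𝓝 1) (𝓝 (oneCoord n G)) :=
  continuousAt_oneChart (mem_extChartAt_source (I := 𝓡 n) (1 : G))

lemma tendsto_oneChart_symm : Tendsto (oneChart n G).symm (𝓝 (oneCoord n G)) (𝓝 1) := by
  have h := continuousAt_oneChart_symm (oneCoord_mem_target (n := n) (G := G))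
  rwa [ContinuousAt, oneChart_symm_oneCoord] at h

lemma eventually_one_of_eventually_oneCoord {p : G → Prop}
    (h : ∀ᶠ u in 𝓝 (oneCoord n G), p ((oneChart n G).symm u)) : ∀ᶠ x in 𝓝 (1 : G), p x := by
  filter_upwards [tendsto_oneChart.eventually h, eventually_mem_oneChart_source (n := n)]
    with x hx hxs
  rwa [(oneChart n G).left_inv hxs] at hx

variable [LieGroup (𝓡 n) ∞ G] {V : Type*} [NormedAddCommGroup V] [NormedSpace ℝ V]

lemma contDiffAt_oneChart_comp {F : V → G} {p : V}
    (hF : ContMDiffAt 𝓘(ℝ, V) (𝓡 n) ∞ F p) (hp : F p ∈ (oneChart n G).source) :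
    ContDiffAt ℝ ∞ (fun v => oneChart n G (F v)) p := by
  rw [← contMDiffAt_iff_contDiffAt]
  have h : ContMDiffAt (𝓡 n) 𝓘(ℝ, EuclideanSpace ℝ (Fin n)) ∞ (oneChart n G) (F p) :=
    contMDiffAt_extChartAt' (by simpa [oneChart] using! hp)
  exact h.comp p hF

lemma contMDiffAt_oneChart_symm_comp {F : V → EuclideanSpace ℝ (Fin n)} {p : V}
    (hF : ContDiffAt ℝ ∞ F p) (hp : F p ∈ (oneChart n G).target) :
    ContMDiffAt 𝓘(ℝ, V) (𝓡 n) ∞ (fun v => (oneChart n G).symm (F v)) p := by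
  have h : ContMDiffAt 𝓘(ℝ, EuclideanSpace ℝ (Fin n)) (𝓡 n) ∞ (oneChart n G).symm (F p) :=
    (contMDiffOn_extChartAt_symm (1 : G)).contMDiffAt
      ((isOpen_extChartAt_target (I := 𝓡 n) (1 : G)).mem_nhds hp)
  exact h.comp p hF.contMDiffAt

end Coordinates

/-! ### Transporting derivatives by left translation -/

section Translation

universe w

variable {n : ℕ} {G : Type*} [TopologicalSpace G] [ChartedSpace (EuclideanSpace ℝ (Fin n)) G]
  [Group G] [LieGroup (𝓡 n) ∞ G]

/-- The derivative of a function on a Lie group at a point near the identity factors through the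
derivative at the identity of its left translate, by a linear map of bounded norm. -/
lemma exists_bounded_hasFDerivAt_of_translate :
    ∃ K : ℝ, ∀ᶠ u in 𝓝 (oneCoord n G),
      ∃ N : EuclideanSpace ℝ (Fin n) →L[ℝ] EuclideanSpace ℝ (Fin n), ‖N‖ ≤ K ∧
        ∀ {F : Type w} [NormedAddCommGroup F] [NormedSpace ℝ F] (f : G → F)
          (L : EuclideanSpace ℝ (Fin n) →L[ℝ] F),
          HasFDerivAt (fun v => f ((oneChart n G).symm u * (oneChart n G).symm v)) L
            (oneCoord n G) →
          HasFDerivAt (fun v => f ((oneChart n G).symm v)) (L.comp N) u := by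
  have : IsTopologicalGroup G := topologicalGroup_of_lieGroup (𝓡 n) ∞
  set e := oneCoord n G
  set φ := oneChart n G
  -- With `g = φ.symm u`, near `v = u` one has `f (φ.symm v) = f (g * φ.symm (ν (u, v)))` and `ν (u,
  -- u) = e`. By the chain rule `N` is the partial derivative of `ν` in its second variable at `(u,
  -- u)`, bounded for `u` near `e` because `ν` is C¹.
  let q : EuclideanSpace ℝ (Fin n) × EuclideanSpace ℝ (Fin n) → G :=
    fun p => (φ.symm p.1)⁻¹ * φ.symm p.2
  let ν : EuclideanSpace ℝ (Fin n) × EuclideanSpace ℝ (Fin n) → EuclideanSpace ℝ (Fin n) :=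
    fun p => φ (q p)
  have hq : ContMDiffAt 𝓘(ℝ, EuclideanSpace ℝ (Fin n) × EuclideanSpace ℝ (Fin n)) (𝓡 n) ∞ q
      (e, e) :=
    ((contMDiffAt_oneChart_symm_comp contDiffAt_fst oneCoord_mem_target).inv).mul
      (contMDiffAt_oneChart_symm_comp contDiffAt_snd oneCoord_mem_target)
  have hq1 : q (e, e) = 1 := by simp [q]
  have hν : ContDiffAt ℝ ∞ ν (e, e) :=
    contDiffAt_oneChart_comp hq (by rw [hq1]; exact mem_extChartAt_source (I := 𝓡 n) (1 : G))
  have hν1 : ContDiffAt ℝ 1 ν (e, e) := hν.of_le (by norm_cast)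
  have hdiag : Tendsto (fun u : EuclideanSpace ℝ (Fin n) => (u, u)) (𝓝 e) (𝓝 (e, e)) :=
    (continuous_id.prodMk continuous_id).tendsto e
  have hbound : ∀ᶠ p in 𝓝 (e, e), ‖fderiv ℝ ν p‖ < ‖fderiv ℝ ν (e, e)‖ + 1 :=
    (hν1.continuousAt_fderiv one_ne_zero).norm.eventually_lt continuousAt_const (lt_add_one _)
  refine ⟨(‖fderiv ℝ ν (e, e)‖ + 1) *
    ‖ContinuousLinearMap.inr ℝ (EuclideanSpace ℝ (Fin n)) (EuclideanSpace ℝ (Fin n))‖, ?_⟩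
  filter_upwards [hdiag.eventually hbound, hdiag.eventually (hν1.eventually (by simp)),
    eventually_mem_oneChart_target (n := n) (G := G)] with u hb hd hu
  refine ⟨(fderiv ℝ ν (u, u)).comp (ContinuousLinearMap.inr ℝ _ _),
    (ContinuousLinearMap.opNorm_comp_le _ _).trans (by gcongr), ?_⟩
  intro F _ _ f L hL
  have h1 : HasFDerivAt (fun v => ν (u, v))
      ((fderiv ℝ ν (u, u)).comp (ContinuousLinearMap.inr ℝ _ _)) u :=
    ((hd.differentiableAt one_ne_zero).hasFDerivAt).comp u (hasFDerivAt_prodMk_right u u)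
  have huu : ν (u, u) = e := by simp [ν, q, e, φ]
  refine ((huu ▸ hL : HasFDerivAt _ L (ν (u, u))).comp u h1).congr_of_eventuallyEq ?_
  have hc : ContinuousAt (fun v => q (u, v)) u :=
    continuousAt_const.mul (continuousAt_oneChart_symm hu)
  have hs : ∀ᶠ v in 𝓝 u, q (u, v) ∈ φ.source :=
    hc.eventually_mem (by
      have : q (u, u) = 1 := by simp [q]
      rw [this]; exact extChartAt_source_mem_nhds (I := 𝓡 n) (1 : G))
  filter_upwards [hs] with v hv
  simp only [Function.comp_apply, ν]
  rw [φ.left_inv hv]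
  simp [q]

end Translation

/-! ### The adjoint action in coordinates -/

section Adjoint

variable {n : ℕ} {G : Type*} [TopologicalSpace G] [ChartedSpace (EuclideanSpace ℝ (Fin n)) G]
  [Group G]

variable (n) in
/-- The adjoint action of a Lie group on its Lie algebra, in the chart at the identity. -/
def adjointMap (g : G) : EuclideanSpace ℝ (Fin n) →L[ℝ] EuclideanSpace ℝ (Fin n) :=
  fderiv ℝ (fun v => oneChart n G (g * (oneChart n G).symm v * g⁻¹)) (oneCoord n G)

lemma adjointMap_one : adjointMap n (1 : G) = ContinuousLinearMap.id ℝ _ := by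
  refine HasFDerivAt.fderiv ((hasFDerivAt_id _).congr_of_eventuallyEq ?_)
  filter_upwards [eventually_mem_oneChart_target (n := n) (G := G)] with u hu
  simp only [one_mul, inv_one, mul_one, id_eq, (oneChart n G).right_inv hu]

variable [LieGroup (𝓡 n) ∞ G]

lemma hasFDerivAt_adjointMap (g : G) :
    HasFDerivAt (fun v => oneChart n G (g * (oneChart n G).symm v * g⁻¹)) (adjointMap n g)
      (oneCoord n G) := by
  refine (ContDiffAt.differentiableAt (n := ∞) ?_ (by simp)).hasFDerivAt
  refine contDiffAt_oneChart_comp ?_ ?_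
  · exact (contMDiffAt_const.mul
      (contMDiffAt_oneChart_symm_comp contDiffAt_id oneCoord_mem_target)).mul contMDiffAt_const
  · rw [oneChart_symm_oneCoord, mul_one, mul_inv_cancel]
    exact mem_extChartAt_source (I := 𝓡 n) (1 : G)

/-- Conjugations compose, and the intermediate chart cancels near the identity, which is all that
the chain rule there requires. -/
lemma adjointMap_mul (g h : G) :
    adjointMap n (g * h) = (adjointMap n g).comp (adjointMap n h) := by
  have : IsTopologicalGroup G := topologicalGroup_of_lieGroup (𝓡 n) ∞
  have hh := hasFDerivAt_adjointMap (n := n) h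
  have hg : HasFDerivAt (fun v => oneChart n G (g * (oneChart n G).symm v * g⁻¹)) (adjointMap n g)
      (oneChart n G (h * (oneChart n G).symm (oneCoord n G) * h⁻¹)) := by
    rw [oneChart_symm_oneCoord, mul_one, mul_inv_cancel]
    exact hasFDerivAt_adjointMap g
  have hgh := HasFDerivAt.comp (oneCoord n G)
    (f := fun v => oneChart n G (h * (oneChart n G).symm v * h⁻¹)) hg hh
  refine HasFDerivAt.fderiv (hgh.congr_of_eventuallyEq ?_)
  have hc : Tendsto (fun v => h * (oneChart n G).symm v * h⁻¹) (𝓝 (oneCoord n G)) (𝓝 1) := by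
    simpa using (tendsto_oneChart_symm (n := n) (G := G)).const_mul h |>.mul_const h⁻¹
  filter_upwards [hc.eventually (eventually_mem_oneChart_source (n := n))] with v hv
  simp only [Function.comp_apply]
  rw [(oneChart n G).left_inv hv]
  congr 1
  group

end Adjoint

/-! ### Second-order expansion of a local multiplication -/

section Bracket

/-- For a local multiplication `μ` with unit `e` and its conjugation `C`, the derivative of the
adjoint map at the unit is the antisymmetrization of the mixed second derivative of `μ`. -/
lemma fderiv_conj_eq_of_local_mul {E : Type*} [NormedAddCommGroup E] [NormedSpace ℝ E]
    {μ C : E × E → E} {e : E}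
    (hμ : ContDiffAt ℝ ∞ μ (e, e)) (hC : ContDiffAt ℝ ∞ C (e, e))
    (hcomp : ∀ᶠ p in 𝓝 (e, e), μ (C p, p.1) = μ p)
    (hCe : ∀ᶠ u in 𝓝 e, C (u, e) = e) (hC1 : ∀ᶠ v in 𝓝 e, C (e, v) = v)
    (hμ1 : ∀ᶠ v in 𝓝 e, μ (v, e) = v) :
    ∃ (A : E →L[ℝ] E →L[ℝ] E) (P : E →L[ℝ] E →L[ℝ] E),
      HasFDerivAt (fun u => fderiv ℝ (fun v => C (u, v)) e) A e ∧
      HasFDerivAt (fun u => fderiv ℝ (fun v => μ (u, v)) e) P e ∧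
      ∀ X Y, A X Y = P X Y - P Y X := by
  have hmk : Tendsto (fun u : E => (u, e)) (𝓝 e) (𝓝 (e, e)) :=
    (continuous_id.prodMk continuous_const).tendsto e
  have hmk' : Tendsto (fun u : E => (e, u)) (𝓝 e) (𝓝 (e, e)) :=
    (continuous_const.prodMk continuous_id).tendsto e
  -- partial derivatives
  have key : ∀ {f : E × E → E}, ContDiffAt ℝ ∞ f (e, e) →
      (∀ᶠ p in 𝓝 (e, e), HasFDerivAt f (fderiv ℝ f p) p) ∧
      HasFDerivAt (fderiv ℝ f) (fderiv ℝ (fderiv ℝ f) (e, e)) (e, e) := by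
    intro f hf
    refine ⟨?_, ?_⟩
    · have h1 : ContDiffAt ℝ 1 f (e, e) := hf.of_le (by norm_cast)
      filter_upwards [h1.eventually (by simp)] with p hp
      exact (hp.differentiableAt one_ne_zero).hasFDerivAt
    · have h2 : ContDiffAt ℝ 1 (fderiv ℝ f) (e, e) :=
        hf.fderiv_right (m := 1) (by norm_cast)
      exact (h2.differentiableAt one_ne_zero).hasFDerivAt
  obtain ⟨hμd, hμ2⟩ := key hμ
  obtain ⟨hCd, hC2⟩ := key hC
  set R := ContinuousLinearMap.inr ℝ E E
  set L := ContinuousLinearMap.inl ℝ E E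
  have part : ∀ {f : E × E → E}, (∀ᶠ p in 𝓝 (e, e), HasFDerivAt f (fderiv ℝ f p) p) →
      HasFDerivAt (fderiv ℝ f) (fderiv ℝ (fderiv ℝ f) (e, e)) (e, e) →
      (∀ᶠ u in 𝓝 e, HasFDerivAt (fun v => f (u, v)) ((fderiv ℝ f (u, e)).comp R) e) ∧
      HasFDerivAt (fun u => fderiv ℝ (fun v => f (u, v)) e)
        (((ContinuousLinearMap.compL ℝ E (E × E) E).flip R).comp
          ((fderiv ℝ (fderiv ℝ f) (e, e)).comp L)) e := by
    intro f hfd hf2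
    have h1 : ∀ᶠ u in 𝓝 e, HasFDerivAt (fun v => f (u, v)) ((fderiv ℝ f (u, e)).comp R) e := by
      filter_upwards [hmk.eventually hfd] with u hu
      exact hu.comp e (hasFDerivAt_prodMk_right u e)
    refine ⟨h1, ?_⟩
    have h2 : HasFDerivAt (fun u => fderiv ℝ f (u, e))
        ((fderiv ℝ (fderiv ℝ f) (e, e)).comp L) e :=
      HasFDerivAt.comp (g := fderiv ℝ f) e hf2 (hasFDerivAt_prodMk_left e e)
    have h3 := (((ContinuousLinearMap.compL ℝ E (E × E) E).flip R).hasFDerivAt).comp e h2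
    refine h3.congr_of_eventuallyEq ?_
    filter_upwards [h1] with u hu
    exact hu.fderiv
  obtain ⟨hμv, hP⟩ := part hμd hμ2
  obtain ⟨hCv, hA⟩ := part hCd hC2
  refine ⟨_, _, hA, hP, fun X Y => ?_⟩
  set P := ((ContinuousLinearMap.compL ℝ E (E × E) E).flip R).comp
    ((fderiv ℝ (fderiv ℝ μ) (e, e)).comp L) with hPdef
  set A := ((ContinuousLinearMap.compL ℝ E (E × E) E).flip R).comp
    ((fderiv ℝ (fderiv ℝ C) (e, e)).comp L)
  -- derivative in `v` at `e` of `μ (C (u, v), u) = μ (u, v)`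
  have hid : ∀ᶠ u in 𝓝 e, fderiv ℝ (fun v => μ (u, v)) e Y =
      fderiv ℝ μ (e, u) (L (fderiv ℝ (fun v => C (u, v)) e Y)) := by
    filter_upwards [hmk.eventually hcomp.eventually_nhds, hCv, hmk'.eventually hμd, hCe]
      with u hu hcu hmu hue
    have h1 : HasFDerivAt (fun v => (C (u, v), u)) (L.comp ((fderiv ℝ C (u, e)).comp R)) e := by
      have := hcu.prodMk (hasFDerivAt_const u e)
      convert this using 1
      ext v <;> simp [L]
    have h2 : HasFDerivAt (fun v => μ (C (u, v), u)) ((fderiv ℝ μ (e, u)).comp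
        (L.comp ((fderiv ℝ C (u, e)).comp R))) e :=
      HasFDerivAt.comp (g := μ) e (by simpa [hue] using hmu) h1
    have h3 : (fun v => μ (u, v)) =ᶠ[𝓝 e] (fun v => μ (C (u, v), u)) := by
      have := (show Tendsto (fun v : E => (u, v)) (𝓝 e) (𝓝 (u, e)) from
        (continuous_const.prodMk continuous_id).tendsto e).eventually hu
      filter_upwards [this] with v hv using hv.symm
    rw [(h2.congr_of_eventuallyEq h3).fderiv, hcu.fderiv]
    rfl
  have hAe : fderiv ℝ (fun v => C (e, v)) e Y = Y := by
    have : (fun v => C (e, v)) =ᶠ[𝓝 e] id := hC1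
    rw [this.fderiv_eq]; simp
  -- This makes the term containing `A X Y` appear without a factor when the identity `hid` is
  -- differentiated in `u` at `e`.
  have hμl : fderiv ℝ μ (e, e) ∘L L = ContinuousLinearMap.id ℝ E := by
    have h1 : HasFDerivAt (fun v => μ (v, e)) (fderiv ℝ μ (e, e) ∘L L) e :=
      HasFDerivAt.comp (g := μ) e hμd.self_of_nhds (hasFDerivAt_prodMk_left e e)
    have h2 : (fun v => μ (v, e)) =ᶠ[𝓝 e] id := hμ1
    exact h1.unique ((hasFDerivAt_id e).congr_of_eventuallyEq h2)
  have hl : HasFDerivAt (fun u => fderiv ℝ (fun v => μ (u, v)) e Y) (P.flip Y) e :=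
    hP.clm_apply (hasFDerivAt_const Y e) |>.congr_fderiv (by ext; simp)
  have hr1 : HasFDerivAt (fun u => fderiv ℝ μ (e, u))
      ((fderiv ℝ (fderiv ℝ μ) (e, e)).comp R) e :=
    hμ2.comp e (hasFDerivAt_prodMk_right e e)
  have hr2 : HasFDerivAt (fun u => L (fderiv ℝ (fun v => C (u, v)) e Y))
      (L.comp (A.flip Y)) e :=
    L.hasFDerivAt.comp e (hA.clm_apply (hasFDerivAt_const Y e) |>.congr_fderiv (by ext; simp))
  have hr := (hr1.clm_apply hr2).congr_of_eventuallyEq hid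
  have := congrArg (fun T : E →L[ℝ] E => T X) (hl.unique hr)
  -- Comparing the two derivatives gives `P X Y = D²μ (R X) (L Y) + A X Y`. Symmetry of the second
  -- derivative turns the mixed term into `P Y X`.
  have hsymm := (hμ.isSymmSndFDerivAt (by simpa using ENat.LEInfty.out)) (R X) (L Y)
  simp only [ContinuousLinearMap.flip_apply, add_apply,
    ContinuousLinearMap.comp_apply, hAe] at this
  have hL := congrArg (fun T : E →L[ℝ] E => T (A X Y)) hμl
  simp only [ContinuousLinearMap.comp_apply, ContinuousLinearMap.id_apply] at hL
  rw [hL, hsymm] at this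
  rw [this]
  simp [hPdef]

end Bracket

/-! ### The derivative of the adjoint action is the bracket -/

section AdjointDerivative

variable {n : ℕ} {G : Type*} [TopologicalSpace G] [ChartedSpace (EuclideanSpace ℝ (Fin n)) G]
  [Group G] [LieGroup (𝓡 n) ∞ G]

open VectorField in
/-- An invariant vector field, read in the chart at the identity. -/
lemma mpullbackWithin_mulInvariantVectorField_oneChart (X : GroupLieAlgebra (𝓡 n) G) :
    ∀ᶠ u in 𝓝 (oneCoord n G),
      mpullbackWithin 𝓘(ℝ, EuclideanSpace ℝ (Fin n)) (𝓡 n) (extChartAt (𝓡 n) (1 : G)).symm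
        (mulInvariantVectorField X) (Set.range (𝓡 n)) u =
      fderiv ℝ (fun v => oneChart n G ((oneChart n G).symm u * (oneChart n G).symm v))
        (oneCoord n G) X := by
  filter_upwards [eventually_mem_oneChart_target (n := n) (G := G)] with u hu
  rw [mpullbackWithin_apply]
  -- Pulling back along the inverse chart is applying the derivative of the chart; composed with
  -- that of left translation, it becomes the derivative of a single function.
  have hinv : (mfderivWithin 𝓘(ℝ, EuclideanSpace ℝ (Fin n)) (𝓡 n)
      (extChartAt (𝓡 n) (1 : G)).symm (Set.range (𝓡 n)) u).inverse =
      mfderiv (𝓡 n) 𝓘(ℝ, EuclideanSpace ℝ (Fin n)) (extChartAt (𝓡 n) (1 : G))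
        ((extChartAt (𝓡 n) (1 : G)).symm u) :=
    ContinuousLinearMap.inverse_eq
      (mfderivWithin_extChartAt_symm_comp_mfderiv_extChartAt hu)
      (mfderiv_extChartAt_comp_mfderivWithin_extChartAt_symm hu)
  rw [hinv]
  set g := (extChartAt (𝓡 n) (1 : G)).symm u
  have hgs : g * 1 ∈ (chartAt (EuclideanSpace ℝ (Fin n)) (1 : G)).source := by
    rw [mul_one, ← extChartAt_source (𝓡 n)]
    exact (extChartAt (𝓡 n) (1 : G)).map_target hu
  have h1 : MDifferentiableAt (𝓡 n) (𝓡 n) (fun y => g * y) (1 : G) :=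
    contMDiff_mul_left.contMDiffAt.mdifferentiableAt (n := ∞) (by simp)
  have h2 : MDifferentiableAt (𝓡 n) 𝓘(ℝ, EuclideanSpace ℝ (Fin n))
      (extChartAt (𝓡 n) (1 : G)) (g * 1) := mdifferentiableAt_extChartAt hgs
  have h3 : mfderiv (𝓡 n) 𝓘(ℝ, EuclideanSpace ℝ (Fin n))
      (fun y => extChartAt (𝓡 n) (1 : G) (g * y)) 1 =
      (mfderiv (𝓡 n) 𝓘(ℝ, EuclideanSpace ℝ (Fin n)) (extChartAt (𝓡 n) (1 : G)) (g * 1)).comp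
        (mfderiv (𝓡 n) (𝓡 n) (fun y => g * y) (1 : G)) := mfderiv_comp 1 h2 h1
  have h4 : mfderiv (𝓡 n) 𝓘(ℝ, EuclideanSpace ℝ (Fin n))
      (fun y => extChartAt (𝓡 n) (1 : G) (g * y)) 1 =
      fderiv ℝ (fun v => oneChart n G (g * (oneChart n G).symm v)) (oneCoord n G) := by
    have hr : Set.range (𝓡 n) = Set.univ := by simp
    have h5 : fderivWithin ℝ (fun v => oneChart n G (g * (oneChart n G).symm v))
        (Set.range (𝓡 n)) (oneCoord n G) =
        fderiv ℝ (fun v => oneChart n G (g * (oneChart n G).symm v)) (oneCoord n G) := by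
      rw [hr, fderivWithin_univ]
    exact (MDifferentiableAt.mfderiv (h2.comp 1 h1)).trans h5
  have h5 := congrArg (fun T : EuclideanSpace ℝ (Fin n) →L[ℝ] EuclideanSpace ℝ (Fin n) => T X)
    (h3.symm.trans h4)
  rw [mul_one] at h5
  exact h5

/-- The derivative of the adjoint action at the identity is the Lie bracket. -/
lemma exists_hasFDerivAt_adjointMap :
    ∃ A : EuclideanSpace ℝ (Fin n) →L[ℝ] EuclideanSpace ℝ (Fin n) →L[ℝ] EuclideanSpace ℝ (Fin n),
      HasFDerivAt (fun u => adjointMap n ((oneChart n G).symm u)) A (oneCoord n G) ∧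
      ∀ X Y : GroupLieAlgebra (𝓡 n) G, A X Y = ⁅X, Y⁆ := by
  have : IsTopologicalGroup G := topologicalGroup_of_lieGroup (𝓡 n) ∞
  set e := oneCoord n G
  set φ := oneChart n G
  have hs1 : (1 : G) ∈ φ.source := mem_extChartAt_source (I := 𝓡 n) (1 : G)
  have hm : ContMDiffAt 𝓘(ℝ, EuclideanSpace ℝ (Fin n) × EuclideanSpace ℝ (Fin n)) (𝓡 n) ∞
      (fun p => φ.symm p.1 * φ.symm p.2) (e, e) :=
    (contMDiffAt_oneChart_symm_comp contDiffAt_fst oneCoord_mem_target).mul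
      (contMDiffAt_oneChart_symm_comp contDiffAt_snd oneCoord_mem_target)
  have hc : ContMDiffAt 𝓘(ℝ, EuclideanSpace ℝ (Fin n) × EuclideanSpace ℝ (Fin n)) (𝓡 n) ∞
      (fun p => φ.symm p.1 * φ.symm p.2 * (φ.symm p.1)⁻¹) (e, e) :=
    hm.mul (contMDiffAt_oneChart_symm_comp contDiffAt_fst oneCoord_mem_target).inv
  have hφe : φ.symm e = 1 := oneChart_symm_oneCoord
  have hφ1 : φ 1 = e := rfl
  obtain ⟨A, P, hA, hP, hAP⟩ := fderiv_conj_eq_of_local_mul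
    (μ := fun p => φ (φ.symm p.1 * φ.symm p.2))
    (C := fun p => φ (φ.symm p.1 * φ.symm p.2 * (φ.symm p.1)⁻¹)) (e := e)
    (contDiffAt_oneChart_comp hm (by simpa [hφe] using hs1))
    (contDiffAt_oneChart_comp hc (by simpa [hφe] using hs1))
    (by
      have : ∀ᶠ p in 𝓝 (e, e), φ.symm p.1 * φ.symm p.2 * (φ.symm p.1)⁻¹ ∈ φ.source :=
        hc.continuousAt.eventually_mem (by
          simp only [hφe, mul_one, inv_one]
          exact extChartAt_source_mem_nhds (I := 𝓡 n) (1 : G))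
      filter_upwards [this] with p hp
      rw [φ.left_inv hp, inv_mul_cancel_right])
    (Eventually.of_forall fun u => by simp [hφe, hφ1])
    (by
      filter_upwards [eventually_mem_oneChart_target (n := n) (G := G)] with v hv
      simp only [hφe, one_mul, inv_one, mul_one]
      exact φ.right_inv hv)
    (by
      filter_upwards [eventually_mem_oneChart_target (n := n) (G := G)] with v hv
      simp only [hφe, mul_one]
      exact φ.right_inv hv)
  refine ⟨A, hA, fun X Y => (hAP X Y).trans ?_⟩
  let VF : EuclideanSpace ℝ (Fin n) → EuclideanSpace ℝ (Fin n) → EuclideanSpace ℝ (Fin n) :=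
    fun Z u => VectorField.mpullbackWithin 𝓘(ℝ, EuclideanSpace ℝ (Fin n)) (𝓡 n)
      (extChartAt (𝓡 n) (1 : G)).symm
      (mulInvariantVectorField (I := 𝓡 n) (G := G) Z) (Set.range (𝓡 n)) u
  have hVF : ∀ Z, VF Z =ᶠ[𝓝 e] fun u => fderiv ℝ (fun v => φ (φ.symm u * φ.symm v)) e Z :=
    fun Z => mpullbackWithin_mulInvariantVectorField_oneChart Z
  have hv : ∀ Z : EuclideanSpace ℝ (Fin n), ∀ W,
      fderiv ℝ (fun u => fderiv ℝ (fun v => φ (φ.symm u * φ.symm v)) e Z) e W = P W Z := by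
    intro Z W
    rw [(hP.clm_apply (hasFDerivAt_const Z e)).fderiv]
    simp
  have h0 : ∀ Z : EuclideanSpace ℝ (Fin n),
      fderiv ℝ (fun v => φ (φ.symm e * φ.symm v)) e Z = Z := by
    intro Z
    have h : (fun v => φ (φ.symm e * φ.symm v)) =ᶠ[𝓝 e] id := by
      filter_upwards [eventually_mem_oneChart_target (n := n) (G := G)] with v hv
      simp only [hφe, one_mul]
      exact φ.right_inv hv
    rw [h.fderiv_eq]; simp
  -- The set `T` is left general because the one in the definition of the bracket is equal to
  -- `Set.univ` only after simplification (`hset`).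
  have hbr : ∀ (X Y : EuclideanSpace ℝ (Fin n)) (T : Set (EuclideanSpace ℝ (Fin n))),
      T = Set.univ → VectorField.lieBracketWithin ℝ (VF X) (VF Y) T e = P X Y - P Y X := by
    rintro X Y T rfl
    rw [VectorField.lieBracketWithin_univ, VectorField.lieBracket, (hVF X).fderiv_eq,
      (hVF Y).fderiv_eq, (hVF X).self_of_nhds.trans (h0 X),
      (hVF Y).self_of_nhds.trans (h0 Y), hv, hv]
  have hset : (extChartAt (𝓡 n) (1 : G)).symm ⁻¹' Set.univ ∩ Set.range (𝓡 n) = Set.univ := by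
    simp
  -- The tangent space at the identity is identified with the model space through this very chart,
  -- so the chart has identity derivative there.
  have hid : (mfderiv (𝓡 n) 𝓘(ℝ, EuclideanSpace ℝ (Fin n)) (extChartAt (𝓡 n) (1 : G)) 1).inverse =
      ContinuousLinearMap.id ℝ (EuclideanSpace ℝ (Fin n)) :=
    (congrArg ContinuousLinearMap.inverse (mfderiv_extChartAt_self (I := 𝓡 n) (x := (1 : G)))).trans
      ContinuousLinearMap.inverse_id
  exact ((congrArg (mfderiv (𝓡 n) 𝓘(ℝ, EuclideanSpace ℝ (Fin n))
    (extChartAt (𝓡 n) (1 : G)) 1).inverse (hbr X Y _ hset)).trans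
    (congrArg (fun T : EuclideanSpace ℝ (Fin n) →L[ℝ] EuclideanSpace ℝ (Fin n) =>
      T (P X Y - P Y X)) hid)).symm

end AdjointDerivative

/-! ### Vanishing criterion and propagation by connectedness -/

/-- A function vanishing at a point, whose derivative is bounded by a multiple of the function,
vanishes near the point. -/
lemma eventually_eq_zero_of_hasFDerivAt_le {E F : Type*} [NormedAddCommGroup E] [NormedSpace ℝ E]
    [ProperSpace E] [NormedAddCommGroup F] [NormedSpace ℝ F] {f : E → F} {e : E} {C : ℝ}
    (h : ∀ᶠ u in 𝓝 e, ∃ D : E →L[ℝ] F, HasFDerivAt f D u ∧ ‖D‖ ≤ C * ‖f u‖) (h0 : f e = 0) :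
    ∀ᶠ u in 𝓝 e, f u = 0 := by
  obtain ⟨r, hr, hball⟩ := Metric.eventually_nhds_iff_ball.1 h
  set c := |C| + 1
  have hc : 0 < c := by positivity
  -- The bound `r / 2` keeps the closed ball inside the region of the hypothesis. With `1 / (2 *
  -- c)`, the mean value inequality at a maximum point `z` of `‖f‖` gives `‖f z‖ ≤ ‖f z‖ / 2`.
  set δ := min (r / 2) (1 / (2 * c))
  have hδ : 0 < δ := by positivity
  have hsub : ∀ u ∈ Metric.closedBall e δ, u ∈ Metric.ball e r := by
    intro u hu
    rw [Metric.mem_closedBall] at hu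
    rw [Metric.mem_ball]
    have : δ ≤ r / 2 := min_le_left _ _
    linarith
  choose! D hD hDC using fun u hu => hball u (hsub u hu)
  have hcont : ContinuousOn (fun u => ‖f u‖) (Metric.closedBall e δ) :=
    fun u hu => (hD u hu).continuousAt.continuousWithinAt.norm
  obtain ⟨z, hz, hmax⟩ := (isCompact_closedBall e δ).exists_isMaxOn
    ⟨e, Metric.mem_closedBall_self hδ.le⟩ hcont
  have hle : ‖f z - f e‖ ≤ (c * ‖f z‖) * ‖z - e‖ :=
    (convex_closedBall e δ).norm_image_sub_le_of_norm_hasFDerivWithin_le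
      (fun u hu => (hD u hu).hasFDerivWithinAt)
      (fun u hu => (hDC u hu).trans (by
        have h1 : ‖f u‖ ≤ ‖f z‖ := hmax hu
        have h2 : C ≤ c := (le_abs_self C).trans (by simp [c])
        gcongr)) (Metric.mem_closedBall_self hδ.le) hz
  have hzδ : ‖z - e‖ ≤ 1 / (2 * c) := by
    rw [← dist_eq_norm]; exact (Metric.mem_closedBall.1 hz).trans (min_le_right _ _)
  have hhalf : (c * ‖f z‖) * ‖z - e‖ ≤ ‖f z‖ / 2 := by
    calc (c * ‖f z‖) * ‖z - e‖ ≤ (c * ‖f z‖) * (1 / (2 * c)) := by gcongr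
      _ = ‖f z‖ / 2 := by field_simp
  rw [h0, sub_zero] at hle
  have hz0 : ‖f z‖ = 0 := le_antisymm (by linarith) (norm_nonneg _)
  filter_upwards [Metric.closedBall_mem_nhds e hδ] with u hu
  have h1 : ‖f u‖ ≤ ‖f z‖ := hmax hu
  exact norm_le_zero_iff.1 (h1.trans hz0.le)

/-- A subgroup that is a neighbourhood of the identity is open, hence also closed. This passes from
local statements to the whole group. -/
lemma Subgroup.eq_top_of_eventually_mem {G : Type*} [TopologicalSpace G] [Group G]
    [IsTopologicalGroup G] [ConnectedSpace G] (H : Subgroup G) (h : ∀ᶠ x in 𝓝 (1 : G), x ∈ H) :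
    H = ⊤ := by
  have ho : IsOpen (H : Set G) := H.isOpen_of_mem_nhds h
  have hc : IsClopen (H : Set G) := ⟨H.isClosed_of_isOpen ho, ho⟩
  exact SetLike.coe_injective (by simpa using! hc.eq_univ ⟨1, H.one_mem⟩)

/-! ### Ideals are invariant under the adjoint action -/

section AdjointInvariance

variable {n : ℕ} {G : Type*} [TopologicalSpace G] [ChartedSpace (EuclideanSpace ℝ (Fin n)) G]
  [Group G] [LieGroup (𝓡 n) ∞ G]

/-- An ideal of the Lie algebra of a connected Lie group is invariant under the adjoint action. -/
lemma adjointMap_mem_of_lie_mem [ConnectedSpace G] (W : Submodule ℝ (EuclideanSpace ℝ (Fin n)))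
    (hW : ∀ X Y : GroupLieAlgebra (𝓡 n) G, Y ∈ W → ⁅X, Y⁆ ∈ W) (g : G)
    {Y : EuclideanSpace ℝ (Fin n)} (hY : Y ∈ W) : adjointMap n g Y ∈ W := by
  have : IsTopologicalGroup G := topologicalGroup_of_lieGroup (𝓡 n) ∞
  set Q : EuclideanSpace ℝ (Fin n) →L[ℝ] EuclideanSpace ℝ (Fin n) := W.starProjection
  set P : EuclideanSpace ℝ (Fin n) →L[ℝ] EuclideanSpace ℝ (Fin n) :=
    ContinuousLinearMap.id ℝ _ - Q
  have hQ : ∀ Z, Z ∈ W → Q Z = Z := fun Z hZ => Submodule.starProjection_eq_self_iff.2 hZ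
  have hQm : ∀ Z, Q Z ∈ W := fun Z => Submodule.starProjection_apply_mem _ _
  have hP : ∀ Z, P Z = 0 → Z ∈ W := by
    intro Z hZ
    have : Z = Q Z := by simpa [P, sub_eq_zero] using hZ
    rw [this]; exact hQm Z
  obtain ⟨A, hA, hAb⟩ := exists_hasFDerivAt_adjointMap (n := n) (G := G)
  obtain ⟨K, hK⟩ := exists_bounded_hasFDerivAt_of_translate.{0} (n := n) (G := G)
  -- With `Q` the orthogonal projection onto `W` and `P = 1 - Q`, the map `f g` is the part of `Ad
  -- g` leading from `W` out of `W`.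
  let f : G → EuclideanSpace ℝ (Fin n) →L[ℝ] EuclideanSpace ℝ (Fin n) :=
    fun g => P ∘L adjointMap n g ∘L Q
  have hnear : ∀ᶠ u in 𝓝 (oneCoord n G), f ((oneChart n G).symm u) = 0 := by
    refine eventually_eq_zero_of_hasFDerivAt_le (C := ‖A‖ * ‖Q‖ * K) ?_ ?_
    · filter_upwards [hK] with u ⟨N, hNK, hN⟩
      set S := ContinuousLinearMap.compL ℝ (EuclideanSpace ℝ (Fin n)) (EuclideanSpace ℝ (Fin n))
        (EuclideanSpace ℝ (Fin n))
      set g := (oneChart n G).symm u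
      have h1 : HasFDerivAt (fun v => f (g * (oneChart n G).symm v))
          ((S (f g)).comp ((S.flip Q).comp A)) (oneCoord n G) := by
        have h2 : HasFDerivAt (fun v => f (g * (oneChart n G).symm v))
            ((S (P ∘L adjointMap n g)).comp ((S.flip Q).comp A)) (oneCoord n G) := by
          have h3 := (S (P ∘L adjointMap n g)).hasFDerivAt.comp (oneCoord n G)
            ((S.flip Q).hasFDerivAt.comp (oneCoord n G) hA)
          refine h3.congr_of_eventuallyEq (Eventually.of_forall fun v => ?_)
          simp only [f, adjointMap_mul]
          rfl
        -- As `W` is an ideal, `A X` maps it into itself, so `P Ad(g) A(X) Q = P Ad(g) Q A(X) Q =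
        -- f(g) A(X) Q`. This factor `f g` bounds the derivative by a multiple of `‖f g‖`.
        refine h2.congr_fderiv ?_
        ext1 X
        ext1 Z
        have h4 : Q (A X (Q Z)) = A X (Q Z) := hQ _ 
          ((congrArg (fun T : EuclideanSpace ℝ (Fin n) => T ∈ W) (hAb X (Q Z))).mpr
            (hW X (Q Z) (hQm Z)))
        change P (adjointMap n g (A X (Q Z))) = P (adjointMap n g (Q (A X (Q Z))))
        rw [h4]
      refine ⟨_, hN f _ h1, ?_⟩
      calc ‖((S (f g)).comp ((S.flip Q).comp A)).comp N‖
          ≤ ‖(S (f g)).comp ((S.flip Q).comp A)‖ * ‖N‖ := ContinuousLinearMap.opNorm_comp_le _ _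
        _ ≤ (‖f g‖ * (‖A‖ * ‖Q‖)) * K := by
          gcongr
          refine ContinuousLinearMap.opNorm_le_bound _ (by positivity) fun X => ?_
          calc ‖f g ∘L (A X ∘L Q)‖ ≤ ‖f g‖ * (‖A X‖ * ‖Q‖) :=
                (ContinuousLinearMap.opNorm_comp_le _ _).trans
                  (by gcongr; exact ContinuousLinearMap.opNorm_comp_le _ _)
            _ ≤ ‖f g‖ * ((‖A‖ * ‖X‖) * ‖Q‖) := by gcongr; exact A.le_opNorm X
            _ = ‖f g‖ * (‖A‖ * ‖Q‖) * ‖X‖ := by ring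
        _ = ‖A‖ * ‖Q‖ * K * ‖f g‖ := by ring
    · ext1 Z
      change P (adjointMap n ((oneChart n G).symm (oneCoord n G)) (Q Z)) = 0
      rw [oneChart_symm_oneCoord, adjointMap_one]
      simp [P, hQ _ (hQm Z)]
  have hnear1 : ∀ᶠ x in 𝓝 (1 : G), f x = 0 := eventually_one_of_eventually_oneCoord hnear
  have hmem : ∀ x : G, f x = 0 → ∀ Z ∈ W, adjointMap n x Z ∈ W := by
    intro x hx Z hZ
    refine hP _ ?_
    have := congrArg (fun T : EuclideanSpace ℝ (Fin n) →L[ℝ] EuclideanSpace ℝ (Fin n) => T Z) hx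
    simpa [f, hQ Z hZ] using this
  -- Imposing the condition on `x⁻¹` as well makes closure under inversion immediate.
  let H : Subgroup G :=
    { carrier := {x | (∀ Z ∈ W, adjointMap n x Z ∈ W) ∧ ∀ Z ∈ W, adjointMap n x⁻¹ Z ∈ W}
      one_mem' := by simp [adjointMap_one]
      mul_mem' := fun {a b} ha hb => by
        simp only [Set.mem_ofPred_eq, mul_inv_rev, adjointMap_mul]
        exact ⟨fun Z hZ => ha.1 _ (hb.1 Z hZ), fun Z hZ => hb.2 _ (ha.2 Z hZ)⟩
      inv_mem' := fun {a} ha => ⟨ha.2, by simpa using ha.1⟩ }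
  have hH : H = ⊤ := by
    refine H.eq_top_of_eventually_mem ?_
    have hinv : Tendsto (fun x : G => x⁻¹) (𝓝 1) (𝓝 1) := by
      simpa using (continuous_inv (G := G)).tendsto 1
    filter_upwards [hnear1, hinv.eventually hnear1] with x hx hx'
    exact ⟨hmem x hx, hmem _ hx'⟩
  have hg : g ∈ H := hH ▸ Subgroup.mem_top g
  exact hg.1 Y hY

end AdjointInvariance


/-! ### Transversal coordinates and normality of immersed subgroups -/

section Transversal

variable {k n : ℕ}
  {K : Type*} [TopologicalSpace K] [ChartedSpace (EuclideanSpace ℝ (Fin k)) K] [Group K]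
  [LieGroup (𝓡 k) ∞ K]
  {G : Type*} [TopologicalSpace G] [ChartedSpace (EuclideanSpace ℝ (Fin n)) G] [Group G]
  [LieGroup (𝓡 n) ∞ G]

/-- The differential at the identity of a smooth homomorphism, in the charts at the identities. -/
lemma hasFDerivAt_lieAlgebraMap (j : K →* G) (hj : ContMDiff (𝓡 k) (𝓡 n) ∞ j) :
    HasFDerivAt (fun v => oneChart n G (j ((oneChart k K).symm v)))
      (lieAlgebraMap k n j : EuclideanSpace ℝ (Fin k) →L[ℝ] EuclideanSpace ℝ (Fin n))
      (oneCoord k K) := by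
  have h1 := (hj.mdifferentiableAt (x := 1) (by simp)).hasMFDerivAt
  have h2 := h1.2
  simp only [writtenInExtChartAt, modelWithCornersSelf_coe, Set.range_id] at h2
  rw [map_one] at h2
  exact HasFDerivWithinAt.hasFDerivAt h2 Filter.univ_mem

/-- The sum of the inclusion of the orthogonal complement of the range of an injective map and
this map, as a linear equivalence. -/
lemma exists_continuousLinearEquiv_orthogonal_range
    (J : EuclideanSpace ℝ (Fin k) →L[ℝ] EuclideanSpace ℝ (Fin n)) (hJ : Function.Injective J) :
    ∃ T : ((LinearMap.range J.toLinearMap)ᗮ × EuclideanSpace ℝ (Fin k)) ≃L[ℝ]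
        EuclideanSpace ℝ (Fin n), ∀ p, T p = (p.1 : EuclideanSpace ℝ (Fin n)) + J p.2 := by
  set W := LinearMap.range J.toLinearMap
  let T : (Wᗮ × EuclideanSpace ℝ (Fin k)) →L[ℝ] EuclideanSpace ℝ (Fin n) :=
    Wᗮ.subtypeL.coprod J
  have hinj : Function.Injective T := by
    rw [injective_iff_map_eq_zero]
    rintro ⟨z, w⟩ h
    have h1 : (z : EuclideanSpace ℝ (Fin n)) + J w = 0 := by simpa [T] using h
    have h2 : (z : EuclideanSpace ℝ (Fin n)) ∈ W := by
      rw [eq_neg_of_add_eq_zero_left h1]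
      exact W.neg_mem ⟨w, rfl⟩
    have h3 : (z : EuclideanSpace ℝ (Fin n)) = 0 := by
      have := W.inner_right_of_mem_orthogonal h2 z.2
      exact inner_self_eq_zero.1 this
    have h4 : w = 0 := hJ (by rw [map_zero]; simpa [h3] using h1)
    simp only [Prod.mk_eq_zero]
    exact ⟨Subtype.ext h3, h4⟩
  have hsurj : Function.Surjective T := by
    intro v
    obtain ⟨y, ⟨w, hw⟩, z, hz, rfl⟩ := W.exists_add_mem_mem_orthogonal v
    refine ⟨(⟨z, hz⟩, w), ?_⟩
    subst hw
    simp [T, add_comm]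
  exact ⟨ContinuousLinearEquiv.ofBijective T (LinearMap.ker_eq_bot.2 hinj)
    (LinearMap.range_eq_top.2 hsurj), fun p => by simp [T]⟩

/-- Near the identity, an immersed subgroup has a transversal coordinate `h`, which is constant
along small pieces of the left cosets and whose zeros lie in the subgroup. -/
lemma exists_transversal_coordinate (j : K →* G) (hj : ContMDiff (𝓡 k) (𝓡 n) ∞ j)
    (J : EuclideanSpace ℝ (Fin k) →L[ℝ] EuclideanSpace ℝ (Fin n))
    (hJ : HasFDerivAt (fun v => oneChart n G (j ((oneChart k K).symm v))) J (oneCoord k K))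
    (hinj : Function.Injective J) :
    ∃ h : G → (LinearMap.range J.toLinearMap)ᗮ, h 1 = 0 ∧ ∀ᶠ g in 𝓝 (1 : G),
      DifferentiableAt ℝ (fun v => h (g * (oneChart n G).symm v)) (oneCoord n G) ∧
      (∀ᶠ y in 𝓝 (1 : K), h (g * j y) = h g) ∧ (h g = 0 → g ∈ j.range) := by
  have : IsTopologicalGroup G := topologicalGroup_of_lieGroup (𝓡 n) ∞
  have : IsTopologicalGroup K := topologicalGroup_of_lieGroup (𝓡 k) ∞
  set Z := (LinearMap.range J.toLinearMap)ᗮ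
  obtain ⟨T, hT⟩ : ∃ T : (Z × EuclideanSpace ℝ (Fin k)) ≃L[ℝ] EuclideanSpace ℝ (Fin n),
      ∀ p, T p = (p.1 : EuclideanSpace ℝ (Fin n)) + J p.2 :=
    exists_continuousLinearEquiv_orthogonal_range J hinj
  set φ := oneChart n G
  set ψ := oneChart k K
  set e := oneCoord n G
  set e' := oneCoord k K
  have hφe : φ.symm e = 1 := oneChart_symm_oneCoord
  have hψe : ψ.symm e' = 1 := oneChart_symm_oneCoord
  have hφ1 : φ 1 = e := rfl
  have hs1 : (1 : G) ∈ φ.source := mem_extChartAt_source (I := 𝓡 n) (1 : G)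
  -- Points near the identity are written as a point of a slice transverse to the subgroup times a
  -- point of the subgroup. In the charts this product map has derivative `T` at `(0, e')`, so the
  -- inverse function theorem applies.
  let q : Z × EuclideanSpace ℝ (Fin k) → G :=
    fun p => φ.symm (e + (p.1 : EuclideanSpace ℝ (Fin n))) * j (ψ.symm p.2)
  have hq1 : q (0, e') = 1 := by simp [q, hφe, hψe]
  have hcd : ContDiffAt ℝ ∞ (fun p : Z × EuclideanSpace ℝ (Fin k) =>
      e + (p.1 : EuclideanSpace ℝ (Fin n))) (0, e') :=
    contDiffAt_const.add (Z.subtypeL.contDiff.contDiffAt.comp _ contDiffAt_fst)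
  have hq : ContMDiffAt 𝓘(ℝ, Z × EuclideanSpace ℝ (Fin k)) (𝓡 n) ∞ q (0, e') := by
    refine ContMDiffAt.mul ?_ ?_
    · exact contMDiffAt_oneChart_symm_comp hcd (by simpa using! oneCoord_mem_target)
    · exact hj.contMDiffAt.comp (0, e')
        (contMDiffAt_oneChart_symm_comp contDiffAt_snd oneCoord_mem_target)
  let Φ : Z × EuclideanSpace ℝ (Fin k) → EuclideanSpace ℝ (Fin n) := fun p => φ (q p)
  have hΦ : ContDiffAt ℝ 1 Φ (0, e') :=
    (contDiffAt_oneChart_comp hq (by rw [hq1]; exact hs1)).of_le (by norm_cast)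
  have hΦe : Φ (0, e') = e := by simp only [Φ, hq1]; rfl
  have hΦ' : HasFDerivAt Φ (T : Z × EuclideanSpace ℝ (Fin k) →L[ℝ] EuclideanSpace ℝ (Fin n))
      (0, e') := by
    have h0 := (hΦ.differentiableAt one_ne_zero).hasFDerivAt
    have h1 : HasFDerivAt (fun z : Z => Φ (z, e')) Z.subtypeL 0 := by
      have h2 : HasFDerivAt (fun z : Z => e + (z : EuclideanSpace ℝ (Fin n))) Z.subtypeL 0 :=
        Z.subtypeL.hasFDerivAt.const_add e
      refine h2.congr_of_eventuallyEq ?_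
      have h3 : ∀ᶠ z : Z in 𝓝 0, e + (z : EuclideanSpace ℝ (Fin n)) ∈ φ.target :=
        h2.continuousAt.eventually_mem (by
          simpa using! eventually_mem_oneChart_target (n := n) (G := G))
      filter_upwards [h3] with z hz
      simp only [Φ, q, hψe, map_one, mul_one]
      exact φ.right_inv hz
    have h4 : HasFDerivAt (fun w => Φ (0, w)) J e' := by
      refine hJ.congr_of_eventuallyEq (Eventually.of_forall fun w => ?_)
      simp [Φ, q, hφe]
    have h5 := h1.unique (HasFDerivAt.comp (g := Φ) (0 : Z) h0 (hasFDerivAt_prodMk_left (0 : Z) e'))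
    have h6 := h4.unique (HasFDerivAt.comp (g := Φ) e' h0 (hasFDerivAt_prodMk_right (0 : Z) e'))
    refine h0.congr_fderiv ?_
    ext1
    · rw [← h5]
      ext1 z
      simp [hT]
    · rw [← h6]
      ext1 w
      simp [hT]
  let Θ := hΦ.toOpenPartialHomeomorph Φ hΦ' one_ne_zero
  have hΘ : ∀ p, Θ p = Φ p := fun _ => rfl
  have hΘs : (0, e') ∈ Θ.source := hΦ.mem_toOpenPartialHomeomorph_source hΦ' one_ne_zero
  have hΘt : e ∈ Θ.target := by
    have := Θ.map_source hΘs
    rwa [hΘ, hΦe] at this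
  have hΘe : Θ.symm e = (0, e') := by
    have := Θ.left_inv hΘs
    rwa [hΘ, hΦe] at this
  have hΘd : ContDiffAt ℝ 1 Θ.symm e := by
    have := hΦ.to_localInverse hΦ' one_ne_zero
    rwa [hΦe] at this
  have hΘc : Tendsto Θ.symm (𝓝 e) (𝓝 (0, e')) := by
    have := hΘd.continuousAt
    rwa [ContinuousAt, hΘe] at this
  -- The coordinate is the slice component of the local inverse. Right multiplication by `j y` with
  -- `y` near `1` moves only the other component.
  refine ⟨fun g => (Θ.symm (φ g)).1, by simp only [hφ1, hΘe], ?_⟩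
  have hφc : Tendsto φ (𝓝 (1 : G)) (𝓝 e) := tendsto_oneChart
  have hqs : ∀ᶠ p in 𝓝 ((0 : Z), e'), q p ∈ φ.source :=
    hq.continuousAt.eventually_mem (by
      rw [hq1]; exact extChartAt_source_mem_nhds (I := 𝓡 n) (1 : G))
  have hpt : ∀ᶠ p in 𝓝 ((0 : Z), e'), p.2 ∈ ψ.target :=
    (continuous_snd.tendsto ((0 : Z), e')).eventually
      (eventually_mem_oneChart_target (n := k) (G := K))
  have hstab : ∀ᶠ p in 𝓝 ((0 : Z), e'), p ∈ Θ.source := Θ.open_source.mem_nhds hΘs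
  filter_upwards [eventually_mem_oneChart_source (n := n) (G := G),
    hφc.eventually (hΘd.eventually (by simp)), hφc.eventually (Θ.open_target.mem_nhds hΘt),
    (hΘc.comp hφc).eventually hqs, (hΘc.comp hφc).eventually hpt]
    with g hgs hgd hgt hgq hgp
  simp only [Function.comp_apply] at hgq hgp
  set p := Θ.symm (φ g) with hp
  have hpg : q p = g := by
    have h1 : Φ p = φ g := Θ.right_inv hgt
    exact φ.injOn hgq hgs h1
  refine ⟨?_, ?_, ?_⟩
  · have h1 : ContDiffAt ℝ ∞ (fun v => φ (g * φ.symm v)) e :=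
      contDiffAt_oneChart_comp (contMDiffAt_const.mul
        (contMDiffAt_oneChart_symm_comp contDiffAt_id oneCoord_mem_target))
        (by rw [hφe, mul_one]; exact hgs)
    have h2 : DifferentiableAt ℝ Θ.symm (φ (g * φ.symm e)) := by
      rw [hφe, mul_one]; exact hgd.differentiableAt one_ne_zero
    exact (DifferentiableAt.comp (g := Θ.symm) e h2 (h1.differentiableAt (by simp))).fst
  · have hxs : ψ.symm p.2 ∈ ψ.source := ψ.map_target hgp
    have hmul : ContinuousAt (fun y : K => ψ.symm p.2 * y) 1 := by fun_prop
    have h1 : ∀ᶠ y in 𝓝 (1 : K), ψ.symm p.2 * y ∈ ψ.source :=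
      hmul.eventually_mem (by
        rw [mul_one]; exact (isOpen_extChartAt_source (I := 𝓡 k) (1 : K)).mem_nhds hxs)
    have h2 : Tendsto (fun y : K => (p.1, ψ (ψ.symm p.2 * y))) (𝓝 1) (𝓝 p) := by
      have h3 : ContinuousAt ψ (ψ.symm p.2 * 1) := by
        rw [mul_one]; exact continuousAt_oneChart hxs
      have h4 : Tendsto (fun y : K => ψ (ψ.symm p.2 * y)) (𝓝 1) (𝓝 p.2) := by
        have := ContinuousAt.comp (g := ψ) (x := (1 : K)) h3 hmul
        rw [ContinuousAt, Function.comp_apply, mul_one, ψ.right_inv hgp] at this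
        exact this
      exact tendsto_const_nhds.prodMk_nhds h4
    have hps : p ∈ Θ.source := Θ.map_target hgt
    filter_upwards [h1, h2.eventually (Θ.open_source.mem_nhds hps)] with y hy hy'
    have h5 : φ (g * j y) = Θ (p.1, ψ (ψ.symm p.2 * y)) := by
      rw [hΘ]
      simp only [Φ, q, ψ.left_inv hy, map_mul]
      rw [← mul_assoc]
      exact congrArg (fun x => φ (x * j y)) hpg.symm
    rw [h5, Θ.left_inv hy']
  -- Only this implication is available in general: a dense subgroup also meets the neighbourhood at
  -- points with nonzero coordinate.
  · intro h0
    refine ⟨ψ.symm p.2, ?_⟩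
    rw [← hpg]
    simp [q, h0, hφe]

/-- A connected immersed Lie subgroup whose Lie algebra is invariant under the adjoint action is
normal. -/
lemma conj_mem_range_of_adjointMap_mem [ConnectedSpace K] (j : K →* G)
    (hj : ContMDiff (𝓡 k) (𝓡 n) ∞ j)
    (J : EuclideanSpace ℝ (Fin k) →L[ℝ] EuclideanSpace ℝ (Fin n))
    (hJ : HasFDerivAt (fun v => oneChart n G (j ((oneChart k K).symm v))) J (oneCoord k K))
    (hinj : Function.Injective J) (s : G)
    (hs : ∀ Y ∈ LinearMap.range J.toLinearMap,
      adjointMap n s Y ∈ LinearMap.range J.toLinearMap) (x : K) :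
    s * j x * s⁻¹ ∈ j.range := by
  have : IsTopologicalGroup G := topologicalGroup_of_lieGroup (𝓡 n) ∞
  have : IsTopologicalGroup K := topologicalGroup_of_lieGroup (𝓡 k) ∞
  obtain ⟨h, h1, hh⟩ := exists_transversal_coordinate j hj J hJ hinj
  obtain ⟨B, hB⟩ := exists_bounded_hasFDerivAt_of_translate.{0} (n := k) (G := K)
  let c : K →* G := (MulAut.conj s).toMonoidHom.comp j
  have hc : ∀ y, c y = s * j y * s⁻¹ := fun _ => rfl
  have hjc : Tendsto j (𝓝 1) (𝓝 1) := by
    simpa using hj.continuous.tendsto 1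
  have hcc : Tendsto c (𝓝 1) (𝓝 1) := by
    have := (hjc.const_mul s).mul_const s⁻¹
    rwa [mul_one, mul_inv_cancel] at this
  have hnear : ∀ᶠ u in 𝓝 (oneCoord k K), h (c ((oneChart k K).symm u)) = 0 := by
    -- The constant is `0` because the derivative of `h ∘ c` vanishes throughout a neighbourhood.
    refine eventually_eq_zero_of_hasFDerivAt_le (C := 0) ?_
      (by rw [oneChart_symm_oneCoord, map_one, h1])
    filter_upwards [hB, (hcc.comp tendsto_oneChart_symm).eventually hh] with u ⟨N, _, hN⟩ hu
    simp only [Function.comp_apply] at hu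
    set g := c ((oneChart k K).symm u)
    obtain ⟨hd, hconst, -⟩ := hu
    set D := fderiv ℝ (fun v => h (g * (oneChart n G).symm v)) (oneCoord n G)
    have hD : HasFDerivAt (fun v => h (g * (oneChart n G).symm v)) D (oneCoord n G) :=
      hd.hasFDerivAt
    have hje : oneChart n G (j ((oneChart k K).symm (oneCoord k K))) = oneCoord n G := by
      rw [oneChart_symm_oneCoord, map_one]
    -- Constancy of `h` along the left coset of `g` makes `D` vanish on the Lie algebra of the
    -- subgroup; as `Ad s` preserves it, `D` also kills the velocities of the conjugated subgroup.
    have hDJ : D.comp J = 0 := by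
      have h2 := HasFDerivAt.comp (g := fun v => h (g * (oneChart n G).symm v)) (oneCoord k K)
        (by rw [hje]; exact hD) hJ
      refine h2.unique ((hasFDerivAt_const (h g) _).congr_of_eventuallyEq ?_)
      filter_upwards [tendsto_oneChart_symm.eventually hconst,
        (hjc.comp tendsto_oneChart_symm).eventually (eventually_mem_oneChart_source (n := n))]
        with v hv hvs
      simp only [Function.comp_apply] at hvs ⊢
      rw [(oneChart n G).left_inv hvs, hv]
    have hcd : HasFDerivAt (fun v => oneChart n G (c ((oneChart k K).symm v)))
        ((adjointMap n s).comp J) (oneCoord k K) := by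
      have h2 := HasFDerivAt.comp
        (g := fun v => oneChart n G (s * (oneChart n G).symm v * s⁻¹)) (oneCoord k K)
        (by rw [hje]; exact hasFDerivAt_adjointMap s) hJ
      refine h2.congr_of_eventuallyEq ?_
      filter_upwards [(hjc.comp tendsto_oneChart_symm).eventually
        (eventually_mem_oneChart_source (n := n))] with v hvs
      simp only [Function.comp_apply] at hvs ⊢
      rw [(oneChart n G).left_inv hvs, hc]
    have hzero : D.comp ((adjointMap n s).comp J) = 0 := by
      ext1 w
      obtain ⟨w', hw'⟩ := hs (J w) ⟨w, rfl⟩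
      have h3 : D (J w') = 0 := congrArg (fun S : EuclideanSpace ℝ (Fin k) →L[ℝ] _ => S w') hDJ
      change D (adjointMap n s (J w)) = 0
      rw [← hw']
      exact h3
    have hce : oneChart n G (c ((oneChart k K).symm (oneCoord k K))) = oneCoord n G := by
      rw [oneChart_symm_oneCoord, map_one]
    have h4 : HasFDerivAt (fun v => h (c ((oneChart k K).symm u * (oneChart k K).symm v)))
        (0 : EuclideanSpace ℝ (Fin k) →L[ℝ] _) (oneCoord k K) := by
      have h5 := HasFDerivAt.comp (g := fun v => h (g * (oneChart n G).symm v)) (oneCoord k K)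
        (by rw [hce]; exact hD) hcd
      rw [hzero] at h5
      refine h5.congr_of_eventuallyEq ?_
      filter_upwards [(hcc.comp tendsto_oneChart_symm).eventually
        (eventually_mem_oneChart_source (n := n))] with v hvs
      simp only [Function.comp_apply] at hvs ⊢
      rw [(oneChart n G).left_inv hvs, map_mul]
    exact ⟨_, hN (fun y => h (c y)) 0 h4, by simp⟩
  have hmem : ∀ᶠ y in 𝓝 (1 : K), y ∈ j.range.comap c := by
    filter_upwards [eventually_one_of_eventually_oneCoord (p := fun y => h (c y) = 0) hnear,
      hcc.eventually hh] with y hy hy'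
    exact hy'.2.2 hy
  have htop := (j.range.comap c).eq_top_of_eventually_mem hmem
  have hx : x ∈ j.range.comap c := htop ▸ Subgroup.mem_top x
  exact hx

end Transversal

end

/-! ### Congruence of the orbits -/

theorem lemma2p1
    {m n k : ℕ}
    -- the Riemannian manifold `(M, g)`
    {M : Type*} [TopologicalSpace M] [T2Space M] [ChartedSpace (EuclideanSpace ℝ (Fin m)) M]
    [IsManifold (𝓡 m) ∞ M] (g : SmoothRiemannianMetric m M)
    -- the connected Lie subgroup `S` of `Isom(M)`, acting transitively on `M`
    {S : Type*} [TopologicalSpace S] [ChartedSpace (EuclideanSpace ℝ (Fin n)) S] [Group S]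
    [LieGroup (𝓡 n) ∞ S] [ConnectedSpace S]
    (ι : S →* isometryGroup g) (hι : IsLieSubgroupOfIsometryGroup ι)
    (htrans : MulAction.IsPretransitive ι.range M)
    -- the ideal `s'` of the Lie algebra of `S`
    (s' : LieIdeal ℝ (GroupLieAlgebra (𝓡 n) S))
    -- the connected Lie subgroup `S'` of `S` with Lie algebra `s'`
    {S' : Type*} [TopologicalSpace S'] [ChartedSpace (EuclideanSpace ℝ (Fin k)) S'] [Group S']
    [LieGroup (𝓡 k) ∞ S'] [ConnectedSpace S']
    (j : S' →* S) (hj : IsLieSubgroup k n j) (hs' : lieSubgroupLieAlgebra k n j = s'.toSubmodule) :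
    ∀ p q : M, IsometricallyCongruent g
      (MulAction.orbit (ι.comp j).range p) (MulAction.orbit (ι.comp j).range q) := by
  intro p q
  have hnormal : ∀ (s : S) (x : S'), s * j x * s⁻¹ ∈ j.range := by
    intro s x
    refine conj_mem_range_of_adjointMap_mem j hj.contMDiff _
      (hasFDerivAt_lieAlgebraMap j hj.contMDiff) (hj.mfderiv_injective 1) s ?_ x
    intro Y hY
    refine adjointMap_mem_of_lie_mem (lieSubgroupLieAlgebra k n j) (fun X Z hZ => ?_) s hY
    have hZ' : Z ∈ s'.toSubmodule := hs' ▸ hZ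
    have h : ⁅X, Z⁆ ∈ s'.toSubmodule := lie_mem_right ℝ _ s' X Z hZ'
    rw [← hs'] at h
    exact h
  obtain ⟨⟨_, s, rfl⟩, hs⟩ := htrans.exists_smul_eq p q
  have hs : ι s • p = q := hs
  refine ⟨ι s, Set.Subset.antisymm ?_ ?_⟩
  · rintro _ ⟨_, ⟨⟨_, x, rfl⟩, rfl⟩, rfl⟩
    obtain ⟨y, hy⟩ := hnormal s x
    refine ⟨⟨_, y, rfl⟩, ?_⟩
    change ι (j y) • q = ι s • ι (j x) • p
    rw [hy, ← hs, ← mul_smul, ← mul_smul, ← map_mul, ← map_mul, inv_mul_cancel_right]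
  -- The reverse inclusion uses conjugation by `s⁻¹`: `x s p = s (s⁻¹ x s) p`.
  · rintro _ ⟨⟨_, x, rfl⟩, rfl⟩
    obtain ⟨y, hy⟩ := hnormal s⁻¹ x
    refine ⟨ι (j y) • p, ⟨⟨_, y, rfl⟩, rfl⟩, ?_⟩
    change ι s • ι (j y) • p = ι (j x) • q
    rw [hy, ← hs, ← mul_smul, ← mul_smul, ← map_mul, ← map_mul]
    congr 2
    group
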